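/- Let $n\ge 1$ and let $\mathfrak g=\mathfrak{sl}(n+1)\ltimes\mathbb C^{n+1}$ be the complex Lie algebra in which $\mathbb C^{n+1}$ is an abelian ideal on which $\mathfrak{sl}(n+1)$ acts by its standard representation. Let $A_{i,j}$ be the matrix units, $E_{p,q}=A_{p,q+1}$, $F_{p,q}=A_{q+1,p}$ $(1\le p\le q\le n)$, $H_i=A_{i,i}-A_{i+1,i+1}$ $(1\le i\le n)$, and let $P_1,\dots,P_{n+1}$ be the standard basis of $\mathbb C^{n+1}$. Let $\omega_1,\dots,\omega_n$ be the fundamental weights, $\omega_i(H_j)=\delta_{i,j}$, and $\omega_0=\omega_{n+1}=0$. For a weight $\nu=\sum_i\nu_i\omega_i$ put $\nu_{k,s}=-\sum_{i=k}^{s}(\nu_i+1)$ for $1\le k\le s\le n$. For $0\le s\le n$ define, in the enveloping algebra, $Q^{(\nu(s))}_{s+1}=1$ and, for $1\le m\le s$, $$Q^{(\nu(s))}_m=\sum_{l=m}^{s}Q^{(\nu(s))}_{l+1}\Big(\prod_{k=m+1}^{l}\nu_{k,s}\Big)F_{m,l}.$$ For a vector $u$ of $\mathfrak{sl}(n+1)$-weight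 $\nu$ in a $\mathfrak g$-module and $1\le i\le n+1$ put $$\varphi_i(u)=\sum_{m=1}^{i}Q^{(\nu(i-1))}_m\Big(\prod_{k=1}^{m-1}\nu_{k,i-1}\Big)P_m\,u ,$$ which is a vector of weight $\nu+\omega_i-\omega_{i-1}$; iterates $\varphi_i^m$ and compositions of the $\varphi_i$ are formed with the weight updated at each step. Let $V$ be a finite-dimensional cyclic $\mathfrak g$-module, $V=\mathcal U(\mathfrak g)v_\mu$, generated by a highest weight vector $v_\mu\ne0$ of $\mathfrak{sl}(n+1)$ (that is, $H_iv_\mu=\mu_iv_\mu$ and $E_{p,q}v_\mu=0$ for all $i$ and all $p\le q$) of weight $\mu=\sum_i\mu_i\omega_i$; then $\mu$ is dominant integral, $\mu_i\in\mathbb Z_{\ge0}$. Let $J_1$ be the least positive integer with $\varphi_1^{J_1}(v_\mu)=0$ and, recursively, for $2\le k\le n+1$ and every tuple of integers $(i_1,\dots,i_{k-1})$ with $0\le i_h<J_h(i_1,\dots,i_{h-1})$ for $1\le h\le k-1$ (an admissible tuple), let $J_k(i_1,\dots,i_{k-1})$ be the least positive integer with $$\varphi_k^{J_k(i_1,\dots,i_{k-1})}\big(\varphi_{k-1}^{i_{k-1}}(\cdots\varphi_1^{i_1}(v_\mu)\cdots)\big)=0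 .$$ Let $\mathcal J^\mu$ be the set of all the numbers $J_1$ and $J_k(i_1,\dots,i_{k-1})$, $2\le k\le n+1$, over all admissible tuples. Then all these numbers exist, and: 1. $J_1\ge1$. 2. The set $\mathcal J^\mu$ is bounded. 3. If $2\le k\le n+1$, $(i_1,\dots,i_{k-1})$ is admissible and $0\le j_l\le i_l$ for $1\le l\le k-1$, then $(j_1,\dots,j_{k-1})$ is admissible and $J_k(i_1,\dots,i_{k-1})\le J_k(j_1,\dots,j_{k-1})$. 4. For $2\le k\le n+1$ and every admissible $(i_1,\dots,i_{k-1})$, $1\le J_k(i_1,\dots,i_{k-1})\le\mu_{k-1}+1$. -/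

import Mathlib

open LieAlgebra LieAlgebra.SpecialLinear

namespace SlAffine

noncomputable section

/-- The column space `ℂ^{n+1}`, as an abelian Lie algebra. -/
abbrev Vec (n : ℕ) : Type := Fin (n + 1) → ℂ

instance (n : ℕ) : LieRing (Vec n) where
  bracket _ _ := 0
  add_lie _ _ _ := (add_zero _).symm
  lie_add _ _ _ := (add_zero _).symm
  lie_self _ := rfl
  leibniz_lie _ _ _ := (add_zero _).symm

instance (n : ℕ) : LieAlgebra ℂ (Vec n) where
  lie_smul c _ _ := (smul_zero c).symm

/-- The standard representation of `sl(n+1)` on `ℂ^{n+1}`, matrices acting on column vectors,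
seen as an action by derivations of the abelian Lie algebra `ℂ^{n+1}`. -/
def stdRep (n : ℕ) : sl (Fin (n + 1)) ℂ →ₗ⁅ℂ⁆ LieDerivation ℂ (Vec n) (Vec n) where
  toFun A :=
    { toLinearMap := Matrix.mulVecLin A.1
      leibniz' := fun _ _ =>
        (map_zero (Matrix.mulVecLin A.1)).trans (sub_zero (0 : Fin (n + 1) → ℂ)).symm }
  map_add' A B := by
    ext x : 1
    exact Matrix.add_mulVec A.1 B.1 x
  map_smul' c A := by
    ext x : 1
    exact Matrix.smul_mulVec c A.1 x
  map_lie' := by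
    intro A B
    ext x : 1
    rw [LieDerivation.commutator_apply]
    change (A.1 * B.1 - B.1 * A.1).mulVec x
      = A.1.mulVec (B.1.mulVec x) - B.1.mulVec (A.1.mulVec x)
    exact (Matrix.sub_mulVec (A.1 * B.1) (B.1 * A.1) x).trans
      (congrArg₂ (· - ·) (Matrix.mulVec_mulVec x A.1 B.1).symm
        (Matrix.mulVec_mulVec x B.1 A.1).symm)

/-- The Lie algebra `sl(n+1) ⋉ ℂ^{n+1}`. -/
abbrev G (n : ℕ) : Type := Vec n ⋊⁅stdRep n⁆ (sl (Fin (n + 1)) ℂ)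

/-!
Indices are counted from `0`: the rows and columns of matrices, and the coordinates of `ℂ^{n+1}`,
are indexed by `Fin (n + 1)`, the simple roots and the fundamental weights by `Fin n`.
The positive root `α_{p,q} = ε_p - ε_{q+1}`, `1 ≤ p ≤ q ≤ n`, corresponds to the pair
`a = p - 1 < b = q` in `Fin (n + 1)`.
-/

/-- The root vector `E_{p,q}` (the matrix unit in row `a = p - 1` and column `b = q`). -/
def E {n : ℕ} (a b : Fin (n + 1)) (h : a < b) : G n :=
  SemiDirectSum.inr (stdRep n) (single a b h.ne (1 : ℂ))

/-- The root vector `F_{p,q}` (the matrix unit in row `b = q` and column `a = p - 1`). -/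
def F {n : ℕ} (a b : Fin (n + 1)) (h : a < b) : G n :=
  SemiDirectSum.inr (stdRep n) (single b a h.ne' (1 : ℂ))

/-- The simple coroots `H_1, …, H_n`. -/
def H {n : ℕ} (l : Fin n) : G n :=
  SemiDirectSum.inr (stdRep n) (singleSubSingle l.castSucc l.succ (1 : ℂ))

/-- The basis vectors `P_1, …, P_{n+1}` of the ideal `ℂ^{n+1}`. -/
def P {n : ℕ} (a : Fin (n + 1)) : G n :=
  SemiDirectSum.inl (stdRep n) (Pi.single a 1)

/-- A weight `μ = ∑ μ_l ω_l` of `sl(n+1)`, given by its coordinates `μ_l = μ(H_l)` with respect to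
the fundamental weights. -/
abbrev Weight (n : ℕ) : Type := Fin n → ℂ

/-- The universal enveloping algebra of `sl(n+1) ⋉ ℂ^{n+1}`. -/
abbrev U (n : ℕ) : Type := UniversalEnvelopingAlgebra ℂ (G n)

/-- The scalars `μ_{k,s} = -∑_{i=k}^{s} (μ_i + 1)`, with `c = k - 1` and `t = s`. -/
def mu {n : ℕ} (μ : Weight n) (c t : Fin (n + 1)) : ℂ :=
  -∑ l : Fin n with c ≤ l.castSucc ∧ l.castSucc < t, (μ l + 1)

/-- `P_i^{(μ(s+1))} = (∏_{k=1}^{i-1} μ_{k,s}) P_i`, with `a = i - 1` and `t = s`. -/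
def PU {n : ℕ} (μ : Weight n) (t a : Fin (n + 1)) : U n :=
  (∏ c ∈ Finset.Iio a, mu μ c t) • UniversalEnvelopingAlgebra.ι ℂ (P a)

/-- `F_{i,j}^{(μ(s))} = (∏_{k=i+1}^{j} μ_{k,s}) F_{i,j}`, with `a = i - 1`, `b = j`, `t = s`. -/
def FU {n : ℕ} (μ : Weight n) (t a b : Fin (n + 1)) (h : a < b) : U n :=
  (∏ c ∈ Finset.Ioo a b, mu μ c t) • UniversalEnvelopingAlgebra.ι ℂ (F a b h)

/-- The elements `Q_k^{(μ(s))}`, `1 ≤ k ≤ s + 1`, with `a = k - 1` and `t = s`, given by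
`Q_{s+1}^{(μ(s))} = 1` and `Q_k^{(μ(s))} = ∑_{l=k}^{s} Q_{l+1}^{(μ(s))} F_{k,l}^{(μ(s))}`
for `k ≤ s`. (They lie in the image of the enveloping algebra of `sl(n+1)`.) -/
def Q {n : ℕ} (μ : Weight n) (t a : Fin (n + 1)) : U n :=
  if a = t then 1
  else ∑ b : {b : Fin (n + 1) // a < b ∧ b ≤ t}, Q μ t b.1 * FU μ t a b.1 b.2.1
termination_by (n + 1) - a.val
decreasing_by
  have _h1 : a.val < b.1.val := b.2.1
  have _h2 := b.1.isLt
  omega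

/-- The element of the enveloping algebra which defines `φ_i` on vectors of weight `μ`:
`∑_{k=1}^{i} Q_k^{(μ(i-1))} P_k^{(μ(i))}`, with `b = i - 1`. -/
def phiU {n : ℕ} (μ : Weight n) (b : Fin (n + 1)) : U n :=
  ∑ a ∈ Finset.Iic b, Q μ b a * PU μ b a

/-- The action of the enveloping algebra on a module. -/
def act {n : ℕ} {V : Type*} [AddCommGroup V] [Module ℂ V] [LieRingModule (G n) V]
    [LieModule ℂ (G n) V] (x : U n) (v : V) : V :=
  UniversalEnvelopingAlgebra.lift ℂ (LieModule.toEnd ℂ (G n) V) x v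

/-- The module `V` is cyclic with generator `v`: `V = U(g) v`. -/
def IsCyclicGenerator {n : ℕ} {V : Type*} [AddCommGroup V] [Module ℂ V] [LieRingModule (G n) V]
    [LieModule ℂ (G n) V] (v : V) : Prop :=
  ∀ w : V, ∃ x : U n, act x v = w

/-- `v` is a highest weight vector for `sl(n+1)` of weight `μ`. -/
structure IsHighestWeightVector {n : ℕ} {V : Type*} [AddCommGroup V] [Module ℂ V]
    [LieRingModule (G n) V] [LieModule ℂ (G n) V] (μ : Weight n) (v : V) : Prop where
  ne_zero : v ≠ 0
  weight : ∀ l : Fin n, ⁅(H l : G n), v⁆ = μ l • v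
  raise : ∀ (a b : Fin (n + 1)) (h : a < b), ⁅(E a b h : G n), v⁆ = 0

/-- The weight `μ + ω_i - ω_{i-1}` (where `ω_0 = ω_{n+1} = 0`), with `b = i - 1`. -/
def shift {n : ℕ} (b : Fin (n + 1)) (μ : Weight n) : Weight n := fun l =>
  μ l + (if l.castSucc = b then 1 else 0) - (if l.succ = b then 1 else 0)

/-- The map `φ_i`, `b = i - 1`, on pairs of a weight and a vector of this weight:
the vector `v` of weight `μ` goes to `φ_i(v)`, of weight `μ + ω_i - ω_{i-1}`. -/
def phi {n : ℕ} {V : Type*} [AddCommGroup V] [Module ℂ V] [LieRingModule (G n) V]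
    [LieModule ℂ (G n) V] (b : Fin (n + 1)) (p : Weight n × V) : Weight n × V :=
  (shift b p.1, act (phiU p.1 b) p.2)

/-- `φ_k^{i_k}(⋯ φ_1^{i_1}(v) ⋯)`, together with its weight, for `v` of weight `μ`. -/
def word {n : ℕ} {V : Type*} [AddCommGroup V] [Module ℂ V] [LieRingModule (G n) V]
    [LieModule ℂ (G n) V] (μ : Weight n) (v : V) :
    (k : ℕ) → k ≤ n + 1 → (Fin k → ℕ) → Weight n × V
  | 0, _, _ => (μ, v)
  | k + 1, h, i =>
    (phi ⟨k, h⟩)^[i (Fin.last k)] (word μ v k (Nat.le_of_succ_le h) (Fin.init i))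

/-- The positive integers `m` with `φ_{k+1}^m(φ_k^{i_k}(⋯ φ_1^{i_1}(v) ⋯)) = 0`. -/
def killing {n : ℕ} {V : Type*} [AddCommGroup V] [Module ℂ V] [LieRingModule (G n) V]
    [LieModule ℂ (G n) V] (μ : Weight n) (v : V) (k : Fin (n + 1)) (i : Fin k.val → ℕ) : Set ℕ :=
  {m | 0 < m ∧ ((phi k)^[m] (word μ v k.val k.isLt.le i)).2 = 0}

/-- The number `J^μ_{k+1}(i_1, …, i_k)`, the least element of `killing μ v k i`. -/
def J {n : ℕ} {V : Type*} [AddCommGroup V] [Module ℂ V] [LieRingModule (G n) V]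
    [LieModule ℂ (G n) V] (μ : Weight n) (v : V) (k : Fin (n + 1)) (i : Fin k.val → ℕ) : ℕ :=
  sInf (killing μ v k i)

/-- The tuples `(i_1, …, i_k)` at which `J^μ_{k+1}` is considered: those with
`i_h < J^μ_h(i_1, …, i_{h-1})` for `1 ≤ h ≤ k`. -/
def Admissible {n : ℕ} {V : Type*} [AddCommGroup V] [Module ℂ V] [LieRingModule (G n) V]
    [LieModule ℂ (G n) V] (μ : Weight n) (v : V) (k : Fin (n + 1)) (i : Fin k.val → ℕ) : Prop :=
  ∀ h : Fin k.val,
    i h < J μ v ⟨h.val, h.isLt.trans k.isLt⟩ (fun l => i (Fin.castLE h.isLt.le l))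

/-- The set `𝒥^μ` of all the numbers `J^μ_1`, `J^μ_k(i_1, …, i_{k-1})`. -/
def JSet {n : ℕ} {V : Type*} [AddCommGroup V] [Module ℂ V] [LieRingModule (G n) V]
    [LieModule ℂ (G n) V] (μ : Weight n) (v : V) : Set ℕ :=
  {j | ∃ (k : Fin (n + 1)) (i : Fin k.val → ℕ), Admissible μ v k i ∧ j = J μ v k i}

end

end SlAffine

namespace SlAffine

/-! Everything follows from three facts about the operators φ. They commute pairwise, once the
weights are updated. They send singular vectors to singular vectors. And φ_k changes the weight by
ε_k, that is by ω_k - ω_{k-1}.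

A nonzero singular vector in a finite-dimensional module has coordinates in ℕ, by sl(2) theory. For
k ≥ 2 each φ_k lowers the coordinate at H_{k-1} by one, so φ_k^{μ_{k-1}+1} kills v. Each φ_1 raises
the coordinate at H_1, so its nonzero iterates would be eigenvectors with infinitely many
eigenvalues. Commutation turns a word with larger exponents into Φ applied to the smaller word, with
Φ commuting with every φ. A power that kills the smaller word therefore kills the larger one, which
gives monotonicity and makes the zero tuple the worst case.

The substance is commutation and singularity. Both become accessible through `phiU_eq_chain`, which
replaces the recursive Q by the one-step recursion `chain`. Commutation (`phiU_comm`) then comes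
from the Serre relations through a Yangian-type identity (`SerreData.chain_comm`,
`SerreData.chain_mul_chain`). Singularity (`IsSingular.phi`) comes from commuting one simple raising
operator through a chain. -/

/-- The elements `p_k` given by `p_0 = q` and `p_{k+1} = f_k p_k + x_k [f_k, p_k]`. -/
def chain {A : Type*} [Ring A] [Algebra ℂ A] (f : ℕ → A) (q : A) (x : ℕ → ℂ) : ℕ → A
  | 0 => q
  | k + 1 => f k * chain f q x k + x k • ⁅f k, chain f q x k⁆

/-! ### Commutation of chains from Serre-type relations. -/

section Chain

set_option linter.unusedSectionVars false

attribute [local instance] LieRing.ofAssociativeRing LieAlgebra.ofAssociativeAlgebra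

variable {A : Type*} [Ring A] [Algebra ℂ A]

theorem chain_congr (f : ℕ → A) (q : A) {x y : ℕ → ℂ} (k : ℕ) (h : ∀ c < k, x c = y c) :
    chain f q x k = chain f q y k := by
  induction k with
  | zero => rfl
  | succ k ih =>
    rw [chain, chain, ih fun c hc => h c (hc.trans k.lt_succ_self), h k k.lt_succ_self]

/-- The relations between the simple lowering operators `f_k` and the first coordinate vector `q`
in the enveloping algebra of lower triangular matrices acting on column vectors. -/
structure SerreData (f : ℕ → A) (q : A) : Prop where
  comm : ∀ j k, k + 2 ≤ j → ⁅f j, f k⁆ = 0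
  serre_succ : ∀ k, ⁅f (k + 1), ⁅f (k + 1), f k⁆⁆ = 0
  serre : ∀ k, ⁅f k, ⁅f (k + 1), f k⁆⁆ = 0
  comm_zero : ∀ k, ⁅f (k + 1), q⁆ = 0
  serre_zero : ⁅f 0, ⁅f 0, q⁆⁆ = 0
  comm_lie_zero : ⁅q, ⁅f 0, q⁆⁆ = 0

theorem lie_mul_eq (a b c : A) : ⁅a, b * c⁆ = ⁅a, b⁆ * c + b * ⁅a, c⁆ := by
  simp only [Ring.lie_def, sub_mul, mul_sub, mul_assoc]; abel

theorem lie_mul_of_lie_eq_zero {a b c : A} (hb : ⁅a, b⁆ = 0) (hc : ⁅a, c⁆ = 0) :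
    ⁅a, b * c⁆ = 0 := by
  rw [Ring.lie_def, sub_eq_zero] at *
  rw [← mul_assoc, hb, mul_assoc, hc, mul_assoc]

theorem lie_lie_of_lie_eq_zero {a b c : A} (hb : ⁅a, b⁆ = 0) (hc : ⁅a, c⁆ = 0) :
    ⁅a, ⁅b, c⁆⁆ = 0 := by
  rw [leibniz_lie, hb, hc, zero_lie, lie_zero, add_zero]

theorem lie_chain_eq_zero {f : ℕ → A} {q e : A} (x : ℕ → ℂ) (k : ℕ) (hq : ⁅e, q⁆ = 0)
    (hf : ∀ j < k, ⁅e, f j⁆ = 0) : ⁅e, chain f q x k⁆ = 0 := by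
  induction k with
  | zero => exact hq
  | succ k ih =>
    have h := ih fun j hj => hf j (hj.trans k.lt_succ_self)
    have hk := hf k k.lt_succ_self
    rw [chain, lie_add, lie_smul, lie_mul_of_lie_eq_zero hk h, lie_lie_of_lie_eq_zero hk h,
      smul_zero, add_zero]

variable {f : ℕ → A} {q : A}

theorem SerreData.lie_chain (H : SerreData f q) (x : ℕ → ℂ) {j k : ℕ} (h : k < j) :
    ⁅f j, chain f q x k⁆ = 0 := by
  refine lie_chain_eq_zero x k ?_ fun i hi => H.comm j i (by omega)
  obtain ⟨j, rfl⟩ := Nat.exists_eq_succ_of_ne_zero (Nat.ne_zero_of_lt h)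
  exact H.comm_zero j

theorem mul_eq_of_lie {a b c : A} (h : ⁅a, b⁆ = c) : b * a = a * b - c := by
  rw [← h, Ring.lie_def]; abel

/-- The derivatives of `chain` along two consecutive generators. -/
theorem SerreData.lie_succ_chain_succ (H : SerreData f q) (x : ℕ → ℂ) (k : ℕ) :
    ⁅f (k + 1), chain f q x (k + 1)⁆ =
      ⁅f (k + 1), f k⁆ * chain f q x k + x k • ⁅⁅f (k + 1), f k⁆, chain f q x k⁆ := by
  have h : ⁅f (k + 1), chain f q x k⁆ = 0 := H.lie_chain x k.lt_succ_self
  have h' := h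
  rw [Ring.lie_def, sub_eq_zero] at h'
  rw [chain, lie_add, lie_smul, leibniz_lie (f (k + 1)) (f k), h, lie_zero, add_zero]
  congr 1
  rw [Ring.lie_def, Ring.lie_def, sub_mul, mul_assoc, mul_assoc, mul_assoc, h']

/-- Bracketing p_k with f_k replaces f_{k-1} by [f_k, f_{k-1}], and f_k commutes with the latter by
the Serre relation. -/
theorem SerreData.lie_lie_chain (H : SerreData f q) (x : ℕ → ℂ) (k : ℕ) :
    ⁅f k, ⁅f k, chain f q x k⁆⁆ = 0 := by
  cases k with
  | zero => exact H.serre_zero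
  | succ k =>
    have h := H.lie_chain x k.lt_succ_self
    rw [H.lie_succ_chain_succ, lie_add, lie_smul, lie_mul_of_lie_eq_zero (H.serre_succ k) h,
      lie_lie_of_lie_eq_zero (H.serre_succ k) h, smul_zero, add_zero]

theorem eq_zero_of_eq_neg_self {a : A} (h : a = -a) : a = 0 := by
  have h2 : (2 : ℂ) • a = 0 := by rw [two_smul]; nth_rewrite 1 [h]; exact neg_add_cancel a
  exact (smul_eq_zero.mp h2).resolve_left two_ne_zero

/-- The Jacobi identity and the Serre relation make the two double brackets equal. The Jacobi
identity, (ad f_k)² p_k = 0 and [f_{k+1}, p_k] = 0 make them opposite. Both therefore vanish. -/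
theorem SerreData.lie_lie_lie_chain (H : SerreData f q) (x : ℕ → ℂ) (k : ℕ) :
    ⁅f k, ⁅⁅f (k + 1), f k⁆, chain f q x k⁆⁆ = 0 ∧
      ⁅⁅f (k + 1), f k⁆, ⁅f k, chain f q x k⁆⁆ = 0 := by
  have h := H.lie_chain x k.lt_succ_self
  have h1 : ⁅f k, ⁅⁅f (k + 1), f k⁆, chain f q x k⁆⁆ =
      ⁅⁅f (k + 1), f k⁆, ⁅f k, chain f q x k⁆⁆ := by
    rw [leibniz_lie, H.serre, zero_lie, zero_add]
  have h3 : ⁅f (k + 1), ⁅f k, chain f q x k⁆⁆ = ⁅⁅f (k + 1), f k⁆, chain f q x k⁆ := by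
    rw [leibniz_lie, h, lie_zero, add_zero]
  have h2 : ⁅⁅f (k + 1), f k⁆, ⁅f k, chain f q x k⁆⁆ =
      -⁅f k, ⁅⁅f (k + 1), f k⁆, chain f q x k⁆⁆ := by
    rw [lie_lie, H.lie_lie_chain, lie_zero, zero_sub, h3]
  have h4 := eq_zero_of_eq_neg_self (h2.trans (congrArg _ h1))
  exact ⟨h1.trans h4, h4⟩

theorem mul_comm_of_lie {a b : A} (h : ⁅a, b⁆ = 0) : a * b = b * a := sub_eq_zero.mp h

/-- Two elements of the form `F a + x [F, a]` commute if their coefficients do, and these satisfy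
the Yangian-type relation `h`. -/
theorem mul_comm_step {F a b a' b' : A} {x y : ℂ} (ha : ⁅F, a⁆ = a') (hb : ⁅F, b⁆ = b')
    (ha' : ⁅F, a'⁆ = 0) (hb' : ⁅F, b'⁆ = 0) (hab : a * b = b * a)
    (h : (y - x) • ⁅a, b'⁆ = a' * b - b' * a) :
    (F * a + x • a') * (F * b + y • b') = (F * b + y • b') * (F * a + x • a') := by
  -- Applying ad F to ab = ba gives this identity; applying ad F once more gives 2[a', b'] = 0,
  -- whence the factor 1/2 below.
  have eab : a * b' - b' * a = b * a' - a' * b := by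
    have h1 := congrArg (fun w => ⁅F, w⁆) hab
    simp only [lie_mul_eq, ha, hb] at h1
    linear_combination (norm := module) h1
  have eab' : a' * b' = b' * a' := by
    have h1 := congrArg (fun w => ⁅F, w⁆) eab
    simp only [lie_mul_eq, lie_sub, ha, hb, ha', hb', zero_mul, mul_zero] at h1
    linear_combination (norm := module) (1 / 2 : ℂ) • h1
  have ra := mul_eq_of_lie ha
  have rb := mul_eq_of_lie hb
  have ra' := mul_comm_of_lie ha'
  have rb' := mul_comm_of_lie hb'
  rw [Ring.lie_def] at h
  have k1 : F * a * (F * b) = F * F * (a * b) - F * (a' * b) := by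
    rw [mul_assoc, ← mul_assoc a, ra]; noncomm_ring
  have k2 : F * b * (F * a) = F * F * (b * a) - F * (b' * a) := by
    rw [mul_assoc, ← mul_assoc b, rb]; noncomm_ring
  have k3 : a' * (F * b) = F * (a' * b) := by rw [← mul_assoc, ← ra', mul_assoc]
  have k4 : b' * (F * a) = F * (b' * a) := by rw [← mul_assoc, ← rb', mul_assoc]
  have h1 := congrArg (fun w => F * w) h
  have h2 := congrArg (fun w => F * w) eab
  simp only [mul_sub, mul_smul_comm] at h1 h2
  simp only [mul_add, add_mul, mul_smul_comm, smul_mul_assoc, k1, k2, k3, k4, eab', hab,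
    mul_assoc]
  linear_combination (norm := module) h1 + x • h2

/-- The Yangian-type relation passes from `a, b` to `F a + x [F, a]` and `F b + y [F, b]`. -/
theorem lie_step {F G a b a' b' a'' b'' : A} {x y : ℂ} (ha : ⁅F, a⁆ = a') (hb : ⁅F, b⁆ = b')
    (ha'' : ⁅F, a''⁆ = 0) (hb'' : ⁅F, b''⁆ = 0)
    (hFG : ⁅F, G⁆ = 0) (hGa : ⁅G, a⁆ = a'') (hGa' : ⁅G, a'⁆ = 0)
    (hab : a * b = b * a)
    (h : (y - x) • ⁅a, b'⁆ = a' * b - b' * a)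
    (h' : (y - x) • ⁅a, b''⁆ = a'' * b - b'' * a)
    (h'' : (y - x) • ⁅a', b''⁆ = a'' * b' - b'' * a') :
    (y - x) • ⁅F * a + x • a', G * b + y • b''⁆ =
      (G * a + x • a'') * (F * b + y • b') - (G * b + y • b'') * (F * a + x • a') := by
  have eab : a * b' - b' * a = b * a' - a' * b := by
    have h1 := congrArg (fun w => ⁅F, w⁆) hab
    simp only [lie_mul_eq, ha, hb] at h1
    linear_combination (norm := module) h1
  have ra := mul_eq_of_lie ha
  have rb := mul_eq_of_lie hb
  have ga := mul_eq_of_lie hGa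
  have ra'' := mul_comm_of_lie ha''
  have rb'' := mul_comm_of_lie hb''
  have ga' := mul_comm_of_lie hGa'
  have fg := mul_comm_of_lie hFG
  rw [Ring.lie_def] at h h' h''
  have k1 : F * a * (G * b) = F * G * (a * b) - F * (a'' * b) := by
    rw [mul_assoc, ← mul_assoc a, ga]; noncomm_ring
  have k2 : G * b * (F * a) = F * G * (b * a) - G * (b' * a) := by
    rw [mul_assoc, ← mul_assoc b, rb, fg]; noncomm_ring
  have k3 : G * a * (F * b) = F * G * (a * b) - G * (a' * b) := by
    rw [mul_assoc, ← mul_assoc a, ra, fg]; noncomm_ring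
  have k4 : a' * (G * b) = G * (a' * b) := by rw [← mul_assoc, ← ga', mul_assoc]
  have k5 : b'' * (F * a) = F * (b'' * a) := by rw [← mul_assoc, ← rb'', mul_assoc]
  have k6 : a'' * (F * b) = F * (a'' * b) := by rw [← mul_assoc, ← ra'', mul_assoc]
  have h1 := congrArg (fun w => G * w) h
  have h2 := congrArg (fun w => G * w) eab
  have h3 := congrArg (fun w => F * w) h'
  simp only [mul_sub, mul_smul_comm] at h1 h2 h3
  rw [Ring.lie_def]
  simp only [mul_add, add_mul, mul_smul_comm, smul_mul_assoc, k1, k2, k3, k4, k5, k6, hab,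
    mul_assoc]
  linear_combination (norm := module) (-(1 + x)) • h1 + (x * (y - x) - x) • h2 + y • h3 + (x * y) • h''

/-- Chains whose parameters differ by a constant commute, and satisfy a Yangian-type relation. -/
theorem SerreData.chain_comm (H : SerreData f q) {x y : ℕ → ℂ} (d : ℂ) (k : ℕ)
    (hd : ∀ c < k, x c - y c = d) :
    chain f q y k * chain f q x k = chain f q x k * chain f q y k ∧
      d • ⁅chain f q y k, ⁅f k, chain f q x k⁆⁆ =
        ⁅f k, chain f q y k⁆ * chain f q x k - ⁅f k, chain f q x k⁆ * chain f q y k := by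
  induction k with
  | zero => simp [chain, H.comm_lie_zero]
  | succ k ih =>
    obtain ⟨hc, h⟩ := ih fun c hc => hd c (hc.trans k.lt_succ_self)
    have hdk := hd k k.lt_succ_self
    have hx := H.lie_chain x k.lt_succ_self
    have hy := H.lie_chain y k.lt_succ_self
    have hx' : ⁅f (k + 1), ⁅f k, chain f q x k⁆⁆ = ⁅⁅f (k + 1), f k⁆, chain f q x k⁆ := by
      rw [leibniz_lie, hx, lie_zero, add_zero]
    have hy' : ⁅f (k + 1), ⁅f k, chain f q y k⁆⁆ = ⁅⁅f (k + 1), f k⁆, chain f q y k⁆ := by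
      rw [leibniz_lie, hy, lie_zero, add_zero]
    obtain ⟨hx1, hx2⟩ := H.lie_lie_lie_chain x k
    obtain ⟨hy1, hy2⟩ := H.lie_lie_lie_chain y k
    rw [← hdk] at h ⊢
    -- Differentiating the Yangian relation along f_{k+1}, and then along f_k, yields its two
    -- companions required by `lie_step`.
    have h2 := congrArg (fun w => ⁅f (k + 1), w⁆) h
    simp only [lie_smul, lie_sub, lie_mul_eq, leibniz_lie (f (k + 1)) (chain f q y k), hx, hy, hx',
      hy', mul_zero, zero_lie, zero_add, add_zero] at h2
    have h3 := congrArg (fun w => ⁅f k, w⁆) h2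
    simp only [lie_smul, lie_sub, lie_mul_eq, leibniz_lie (f k) (chain f q y k), hx1, hy1,
      zero_mul, lie_zero, zero_add, add_zero] at h3
    refine ⟨mul_comm_step rfl rfl (H.lie_lie_chain y k) (H.lie_lie_chain x k) hc h, ?_⟩
    rw [H.lie_succ_chain_succ, H.lie_succ_chain_succ]
    exact lie_step rfl rfl hy1 hx1 (H.serre k) rfl hy2 hc h h2 h3

/-- Moving p_k(y) across f_k leaves a commutator. With d = x_k the Yangian relation says exactly
that lowering x_k by one absorbs it. -/
theorem SerreData.chain_mul_chain_succ (H : SerreData f q) {x y : ℕ → ℂ} (k : ℕ)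
    (hd : ∀ c < k, x c - y c = x k) :
    chain f q y k * chain f q x (k + 1) =
      chain f q (Function.update x k (x k - 1)) (k + 1) * chain f q y k := by
  obtain ⟨hc, h⟩ := H.chain_comm (x k) k hd
  have hu : chain f q (Function.update x k (x k - 1)) k = chain f q x k :=
    chain_congr f q k fun c hc => Function.update_of_ne hc.ne _ _
  rw [chain, chain, hu, Function.update_self]
  generalize hF : ⁅f k, chain f q x k⁆ = b' at h
  generalize hG : ⁅f k, chain f q y k⁆ = a' at h
  generalize chain f q x k = b at *
  generalize chain f q y k = a at *
  have k1 : a * (f k * b) = f k * (a * b) - a' * b := by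
    rw [← mul_assoc, mul_eq_of_lie hG]; noncomm_ring
  have k2 : f k * b * a = f k * (a * b) := by rw [mul_assoc, hc]
  rw [Ring.lie_def] at h
  simp only [mul_add, add_mul, mul_smul_comm, smul_mul_assoc, k1, k2]
  linear_combination (norm := module) h

/-- Interchanging chains of different lengths shifts one of the parameters. -/
theorem SerreData.chain_mul_chain (H : SerreData f q) {x y : ℕ → ℂ} {s t : ℕ} (hst : s < t)
    (hd : ∀ c < s, x c - y c = x s) :
    chain f q y s * chain f q x t =
      chain f q (Function.update x s (x s - 1)) t * chain f q y s := by
  induction t, hst using Nat.le_induction with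
  | base => exact H.chain_mul_chain_succ s hd
  | succ t hst ih =>
    have hts : t ≠ s := by omega
    -- Past length s + 1 the new generator f_t commutes with the shorter chain, so the interchange
    -- passes unchanged through the recursion.
    have hf := mul_comm_of_lie (H.lie_chain y (show s < t by omega))
    rw [chain, chain, Function.update_of_ne hts]
    simp only [Ring.lie_def, mul_add, add_mul, mul_smul_comm, smul_mul_assoc, mul_sub, sub_mul]
    have e1 : chain f q y s * (f t * chain f q x t) =
        f t * chain f q (Function.update x s (x s - 1)) t * chain f q y s := by
      rw [← mul_assoc, ← hf, mul_assoc, ih, mul_assoc]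
    have e2 : chain f q y s * (chain f q x t * f t) =
        chain f q (Function.update x s (x s - 1)) t * f t * chain f q y s := by
      rw [← mul_assoc, ih, mul_assoc, ← hf, mul_assoc]
    rw [e1, e2]

end Chain

noncomputable section

/-! ### Chains as solutions of a triangular system. -/

section ChainSum
attribute [local instance] LieRing.ofAssociativeRing LieAlgebra.ofAssociativeAlgebra

variable {A : Type*} [Ring A] [Algebra ℂ A]

/-- Expansion of a chain as a sum over its last step. -/
theorem chain_eq_sum {N : ℕ} {f : ℕ → A} {e : ℕ → ℕ → A} {p : ℕ → A}
    (hfp : ∀ k < N, ⁅f k, p k⁆ = p (k + 1)) (hfe : ∀ k < N, ∀ a < k, ⁅f k, e k a⁆ = e (k + 1) a)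
    (hf : ∀ k < N, f k = e (k + 1) k) (hcomm : ∀ x a k, a < k → ⁅f k, chain f (p 0) x a⁆ = 0)
    (x : ℕ → ℂ) (k : ℕ) (hk : k ≤ N) :
    chain f (p 0) x k =
      (∑ a ∈ Finset.range k, (∏ c ∈ Finset.Ioo a k, x c) • (e k a * chain f (p 0) x a)) +
        (∏ c ∈ Finset.range k, x c) • p k := by
  induction k with
  | zero => simp [chain]
  | succ k ih =>
    have hkN : k < N := hk
    -- Since f_k commutes with the shorter chains, ad f_k acts only on the last factor: e k a moves
    -- to e (k+1) a, and p k to p (k+1). The factor x_k then extends each product, while f_k p_k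
    -- supplies the new term a = k.
    have h1 : ⁅f k, chain f (p 0) x k⁆ =
        (∑ a ∈ Finset.range k, (∏ c ∈ Finset.Ioo a k, x c) •
          (e (k + 1) a * chain f (p 0) x a)) + (∏ c ∈ Finset.range k, x c) • p (k + 1) := by
      conv_lhs => rw [ih hkN.le]
      rw [lie_add, lie_sum, lie_smul, hfp k hkN]
      congr 1
      refine Finset.sum_congr rfl fun a ha => ?_
      rw [lie_smul, lie_mul_eq, hfe k hkN a (Finset.mem_range.mp ha),
        hcomm x a k (Finset.mem_range.mp ha), mul_zero, add_zero]
    rw [chain, h1, Finset.sum_range_succ, Finset.prod_range_succ, smul_add, smul_smul, mul_comm,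
      Finset.smul_sum, hf k hkN]
    have h2 : Finset.Ioo k (k + 1) = ∅ := by ext; simp
    rw [h2, Finset.prod_empty, one_smul, ← hf k hkN, ← add_assoc]
    congr 1
    rw [add_comm]
    congr 1
    refine Finset.sum_congr rfl fun a ha => ?_
    have h3 : Finset.Ioo a (k + 1) = insert k (Finset.Ioo a k) := by
      have := Finset.mem_range.mp ha
      ext; simp; omega
    rw [smul_smul, h3, Finset.prod_insert (by simp)]

end ChainSum

/-! ### Structure constants of the semidirect product. -/

section Brackets

variable {n : ℕ}

/-- Matrix units in `sl(n+1)` off the diagonal. -/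
def unit (i j : Fin (n + 1)) (h : i ≠ j) : G n :=
  SemiDirectSum.inr (stdRep n) (single i j h (1 : ℂ))

theorem lie_inr_inr (A B : sl (Fin (n + 1)) ℂ) :
    ⁅(SemiDirectSum.inr (stdRep n) A : G n), (SemiDirectSum.inr (stdRep n) B : G n)⁆ =
      SemiDirectSum.inr (stdRep n) ⁅A, B⁆ := (LieHom.map_lie _ _ _).symm

theorem lie_inr_inl (A : sl (Fin (n + 1)) ℂ) (w : Vec n) :
    ⁅(SemiDirectSum.inr (stdRep n) A : G n), (SemiDirectSum.inl (stdRep n) w : G n)⁆ =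
      SemiDirectSum.inl (stdRep n) (A.1.mulVec w) := by
  simp
  rfl

theorem lie_inl_inl (w w' : Vec n) :
    ⁅(SemiDirectSum.inl (stdRep n) w : G n), (SemiDirectSum.inl (stdRep n) w' : G n)⁆ = 0 := by
  rw [← LieHom.map_lie]
  exact map_zero _

theorem lie_unit_unit_of_ne {i j k l : Fin (n + 1)} (h : i ≠ j) (h' : k ≠ l) (hjk : j ≠ k)
    (hil : i ≠ l) : ⁅unit i j h, unit k l h'⁆ = 0 := by
  have : ⁅single i j h (1 : ℂ), single k l h' (1 : ℂ)⁆ = 0 := by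
    ext : 1
    rw [sl_bracket]
    simp [Matrix.single_mul_single_of_ne, hjk, hil.symm]
  rw [unit, unit, lie_inr_inr, this, map_zero]

theorem lie_unit_unit {i j l : Fin (n + 1)} (h : i ≠ j) (h' : j ≠ l) (hil : i ≠ l) :
    ⁅unit i j h, unit j l h'⁆ = unit i l hil := by
  rw [unit, unit, lie_inr_inr, unit]
  congr 1
  ext : 1
  rw [sl_bracket]
  simp [Matrix.single_mul_single_of_ne, hil.symm]

theorem lie_unit_unit_swap (l : Fin n) :
    ⁅unit l.castSucc l.succ l.castSucc_lt_succ.ne, unit l.succ l.castSucc l.castSucc_lt_succ.ne'⁆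
      = H l := by
  rw [unit, unit, lie_inr_inr, H]
  congr 1
  ext : 1
  rw [sl_bracket]
  simp

theorem lie_unit_P {i j : Fin (n + 1)} (h : i ≠ j) : ⁅unit i j h, P j⁆ = P i := by
  rw [unit, P, lie_inr_inl, P]
  congr 1
  ext a
  simp [Matrix.single_apply, Pi.single_apply, eq_comm]

theorem lie_unit_P_of_ne {i j k : Fin (n + 1)} (h : i ≠ j) (hjk : j ≠ k) :
    ⁅unit i j h, P k⁆ = 0 := by
  have : (single i j h (1 : ℂ)).1.mulVec (Pi.single k 1) = 0 := by
    ext a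
    simp [hjk]
  rw [unit, P, lie_inr_inl, this, map_zero]

theorem lie_P_P (i j : Fin (n + 1)) : ⁅(P i : G n), (P j : G n)⁆ = 0 := lie_inl_inl _ _

/-- The value of `ε_a` at the coroot `H_l`. -/
def epsH (l a : ℕ) : ℂ := (if a = l then 1 else 0) - (if a = l + 1 then 1 else 0)

theorem lie_H_P (l : Fin n) (a : Fin (n + 1)) :
    ⁅(H l : G n), (P a : G n)⁆ = epsH l a • P a := by
  rw [H, P, lie_inr_inl, ← map_smul]
  congr 1
  ext b
  simp [Matrix.single_apply, Pi.single_apply, epsH, Fin.ext_iff]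
  grind

theorem lie_H_unit (l : Fin n) {i j : Fin (n + 1)} (h : i ≠ j) :
    ⁅(H l : G n), unit i j h⁆ = (epsH l i - epsH l j) • unit i j h := by
  rw [H, unit, lie_inr_inr, ← map_smul]
  congr 1
  ext : 1
  rw [sl_bracket]
  simp only [val_singleSubSingle, val_single, ← Matrix.diagonal_single]
  ext a b
  simp [mul_sub, Matrix.single_apply, epsH, Fin.ext_iff, Pi.single_apply]
  grind

end Brackets

/-! ### The elements defining φ as chains, and their commutation. -/

section Enveloping
attribute [local instance] LieRing.ofAssociativeRing LieAlgebra.ofAssociativeAlgebra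

variable {n : ℕ}

/-- Lowering matrix units in the enveloping algebra, indexed by natural numbers. -/
def lowU (n : ℕ) (b a : ℕ) : U n :=
  if h : a < b ∧ b < n + 1 then
    UniversalEnvelopingAlgebra.ι ℂ
      (unit ⟨b, h.2⟩ ⟨a, h.1.trans h.2⟩ (by simpa [Fin.ext_iff] using h.1.ne'))
  else 0

/-- The translations in the enveloping algebra, indexed by natural numbers. -/
def vecU (n : ℕ) (a : ℕ) : U n :=
  if h : a < n + 1 then UniversalEnvelopingAlgebra.ι ℂ (P ⟨a, h⟩) else 0

theorem lie_lowU_lowU {a b c : ℕ} (hab : b < a) (hbc : c < b) :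
    ⁅lowU n a b, lowU n b c⁆ = lowU n a c := by
  unfold lowU
  by_cases ha : a < n + 1
  · rw [dif_pos ⟨hab, ha⟩, dif_pos ⟨hbc, hab.trans ha⟩, dif_pos ⟨hbc.trans hab, ha⟩,
      ← LieHom.map_lie, lie_unit_unit]
  · rw [dif_neg (by omega), dif_neg (c := c < a ∧ _) (by omega), zero_lie]

theorem lie_lowU_lowU_of_ne {a b c d : ℕ} (hbc : b ≠ c) (had : a ≠ d) :
    ⁅lowU n a b, lowU n c d⁆ = 0 := by
  unfold lowU
  split_ifs with h h'
  · rw [← LieHom.map_lie, lie_unit_unit_of_ne _ _ (by simpa [Fin.ext_iff] using hbc)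
      (by simpa [Fin.ext_iff] using had), map_zero]
  all_goals simp

theorem lie_lowU_vecU {a b : ℕ} (hab : b < a) : ⁅lowU n a b, vecU n b⁆ = vecU n a := by
  unfold lowU vecU
  by_cases ha : a < n + 1
  · rw [dif_pos ⟨hab, ha⟩, dif_pos (hab.trans ha), dif_pos ha, ← LieHom.map_lie, lie_unit_P]
  · rw [dif_neg (by omega), dif_neg ha, zero_lie]

theorem lie_lowU_vecU_of_ne {a b c : ℕ} (hbc : b ≠ c) : ⁅lowU n a b, vecU n c⁆ = 0 := by
  unfold lowU vecU
  split_ifs with h h'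
  · rw [← LieHom.map_lie, lie_unit_P_of_ne _ (by simpa [Fin.ext_iff] using hbc), map_zero]
  all_goals simp

theorem lie_vecU_vecU (a b : ℕ) : ⁅vecU n a, vecU n b⁆ = 0 := by
  unfold vecU
  split_ifs with h h'
  · rw [← LieHom.map_lie, lie_P_P, map_zero]
  all_goals simp

/-- The simple lowering operators. -/
def simpleU (n : ℕ) (k : ℕ) : U n := lowU n (k + 1) k

/-- Out-of-range operators are zero by convention, so the matrix-unit relations hold for all natural
indices and need no bounds. -/
theorem serreData_simpleU (n : ℕ) : SerreData (simpleU n) (vecU n 0) where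
  comm j k h := lie_lowU_lowU_of_ne (by omega) (by omega)
  serre_succ k := by
    rw [simpleU, simpleU, lie_lowU_lowU (by omega) (by omega)]
    exact lie_lowU_lowU_of_ne (by omega) (by omega)
  serre k := by
    rw [simpleU, simpleU, lie_lowU_lowU (by omega) (by omega)]
    exact lie_lowU_lowU_of_ne (by omega) (by omega)
  comm_zero k := lie_lowU_vecU_of_ne (by omega)
  serre_zero := by
    rw [simpleU, lie_lowU_vecU (by omega)]
    exact lie_lowU_vecU_of_ne (by omega)
  comm_lie_zero := by
    rw [simpleU, lie_lowU_vecU (by omega)]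
    exact lie_vecU_vecU _ _

/-- The scalars `mu`, indexed by natural numbers. -/
def muNat (ν : Weight n) (c t : ℕ) : ℂ :=
  -∑ l ∈ Finset.Ico c t, ((if h : l < n then ν ⟨l, h⟩ else 0) + 1)

theorem mu_eq_muNat (ν : Weight n) (c t : Fin (n + 1)) : mu ν c t = muNat ν c t := by
  rw [mu, muNat]
  congr 1
  refine Finset.sum_bij (fun l _ => l.val) (fun l hl => ?_) (fun _ _ _ _ h => Fin.ext h)
    (fun l hl => ?_) (fun l _ => ?_)
  · exact Finset.mem_Ico.mpr (Finset.mem_filter.mp hl).2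
  · have := Finset.mem_Ico.mp hl
    exact ⟨⟨l, by omega⟩, Finset.mem_filter.mpr ⟨Finset.mem_univ _, this⟩, rfl⟩
  · simp

theorem chain_simpleU_eq_sum (x : ℕ → ℂ) (k : Fin (n + 1)) :
    chain (simpleU n) (vecU n 0) x k =
      (∑ a : Fin (n + 1), if h : a < k then
        (∏ c ∈ Finset.Ioo a k, x c) •
          (UniversalEnvelopingAlgebra.ι ℂ (F a k h) * chain (simpleU n) (vecU n 0) x a) else 0) +
        (∏ c ∈ Finset.Iio k, x c) • UniversalEnvelopingAlgebra.ι ℂ (P k) := by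
  rw [chain_eq_sum (N := n) (f := simpleU n) (e := lowU n) (p := vecU n)
    (fun k _ => lie_lowU_vecU k.lt_succ_self)
    (fun k _ a ha => lie_lowU_lowU k.lt_succ_self ha) (fun k _ => rfl)
    (fun x a k h => (serreData_simpleU n).lie_chain x h) x k (Nat.lt_succ_iff.mp k.isLt)]
  congr 1
  · rw [← Finset.sum_subset (Finset.subset_univ (Finset.Iio k))
      (fun a _ ha => dif_neg (by simpa using ha)),
      ← Nat.Iio_eq_range,
      ← Fin.map_valEmbedding_Iio, Finset.sum_map]
    refine Finset.sum_congr rfl fun a ha => ?_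
    have h : a < k := Finset.mem_Iio.mp ha
    rw [dif_pos h, Fin.valEmbedding_apply, ← Fin.map_valEmbedding_Ioo, Finset.prod_map, lowU,
      dif_pos ⟨h, k.isLt⟩]
    rfl
  · rw [← Nat.Iio_eq_range,
      ← Fin.map_valEmbedding_Iio, Finset.prod_map, vecU, dif_pos k.isLt]
    rfl

/-- The element defining `φ` is a chain: the row `Q` and the column of chains solve the same
unitriangular system. -/
theorem phiU_eq_chain (ν : Weight n) (t : Fin (n + 1)) :
    phiU ν t = chain (simpleU n) (vecU n 0) (fun c => muNat ν c t) t := by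
  set p : Fin (n + 1) → U n := fun a => chain (simpleU n) (vecU n 0) (fun c => muNat ν c t) a
    with hp
  let N : Fin (n + 1) → Fin (n + 1) → U n := fun b a => if h : a < b then FU ν t a b h else 0
  -- With N strictly lower triangular, the column system is PU = (1 - N) p and the row system below
  -- is Q (1 - N) = e_t. Hence Q · PU = Q (1 - N) p = p_t, with no inverse needed.
  have hcol : ∀ b, PU ν t b = p b - ∑ a, N b a * p a := by
    intro b
    have h := chain_simpleU_eq_sum (fun c => muNat ν c t) b
    rw [eq_sub_iff_add_eq, add_comm]
    refine Eq.trans ?_ h.symm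
    congr 1
    · refine Finset.sum_congr rfl fun a _ => ?_
      simp only [N]
      split_ifs with hab
      · simp only [FU, smul_mul_assoc, mu_eq_muNat]
        rfl
      · rw [zero_mul]
    · simp only [PU, mu_eq_muNat]
  have hrow : ∀ a ≤ t, Q ν t a = (if a = t then 1 else 0) + ∑ b ∈ Finset.Iic t, Q ν t b * N b a := by
    intro a ha
    rw [Q]
    split_ifs with h
    · subst h
      rw [Finset.sum_eq_zero, add_zero]
      intro b hb
      have : ¬ a < b := not_lt.mpr (Finset.mem_Iic.mp hb)
      simp [N, this]
    · rw [zero_add]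
      refine Finset.sum_of_injOn Subtype.val Subtype.val_injective.injOn
        (fun b _ => Finset.mem_coe.mpr (Finset.mem_Iic.mpr b.2.2)) (fun b hb hb' => ?_)
        fun b _ => by simp only [N, dif_pos b.2.1]
      have : ¬ a < b := fun hab =>
        hb' ⟨⟨b, hab, Finset.mem_Iic.mp hb⟩, Finset.mem_coe.mpr (Finset.mem_univ _), rfl⟩
      simp [N, this]
  -- Rows of index at most t involve only columns of index at most t, so both systems can be
  -- truncated there.
  have hN : ∀ b ∈ Finset.Iic t, ∀ a ∉ Finset.Iic t, N b a = 0 := by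
    intro b hb a ha
    have : ¬ a < b := fun h => ha (Finset.mem_Iic.mpr (h.le.trans (Finset.mem_Iic.mp hb)))
    simp [N, this]
  have hcol' : ∀ b ∈ Finset.Iic t, PU ν t b = p b - ∑ a ∈ Finset.Iic t, N b a * p a := by
    intro b hb
    rw [hcol, Finset.sum_subset (Finset.subset_univ (Finset.Iic t))]
    intro a _ ha
    rw [hN b hb a ha, zero_mul]
  calc phiU ν t = ∑ b ∈ Finset.Iic t, Q ν t b * PU ν t b := rfl
    _ = ∑ b ∈ Finset.Iic t, (Q ν t b * p b -
          ∑ a ∈ Finset.Iic t, Q ν t b * N b a * p a) := by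
        refine Finset.sum_congr rfl fun b hb => ?_
        rw [hcol' b hb, mul_sub, Finset.mul_sum]
        simp only [mul_assoc]
    _ = ∑ b ∈ Finset.Iic t, Q ν t b * p b -
          ∑ a ∈ Finset.Iic t, (∑ b ∈ Finset.Iic t, Q ν t b * N b a) * p a := by
        rw [Finset.sum_sub_distrib, Finset.sum_comm]
        simp only [Finset.sum_mul]
    _ = ∑ a ∈ Finset.Iic t, (if a = t then p a else 0) := by
        rw [← Finset.sum_sub_distrib]
        refine Finset.sum_congr rfl fun a ha => ?_
        conv_lhs => rw [hrow a (Finset.mem_Iic.mp ha)]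
        split_ifs <;> noncomm_ring
    _ = p t := by simp

/-- Adding ε_t leaves the parameters of the shorter chain unchanged. Adding ε_s changes two adjacent
coordinates of the weight by opposite amounts, which cancel in every μ_{c,t} except at c = s, where
the parameter drops by one. This is the shift in `SerreData.chain_mul_chain`. -/
theorem phiU_comm (ν : Weight n) {s t : Fin (n + 1)} (hst : s < t) :
    phiU (shift t ν) s * phiU ν t = phiU (shift s ν) t * phiU ν s := by
  have hmu : ∀ (r : Fin (n + 1)) (c t : ℕ), c ≤ t → t ≤ n → muNat (shift r ν) c t = muNat ν c t -
      (if (r : ℕ) ∈ Finset.Ico c t then 1 else 0) +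
      (if (r : ℕ) ∈ Finset.Ioc c t then 1 else 0) := by
    intro r c t hct htn
    have h1 : ∀ l ∈ Finset.Ico c t, ((if h : l < n then shift r ν ⟨l, h⟩ else 0) + 1) =
        ((if h : l < n then ν ⟨l, h⟩ else 0) + 1) + (if l = r then 1 else 0) -
          (if l + 1 = r then 1 else 0) := by
      intro l hl
      have hl := Finset.mem_Ico.mp hl
      have hln : l < n := by omega
      simp only [dif_pos hln, shift, Fin.ext_iff, Fin.val_castSucc, Fin.val_succ]
      ring
    rw [muNat, muNat, Finset.sum_congr rfl h1, Finset.sum_sub_distrib, Finset.sum_add_distrib]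
    have h2 : (∑ l ∈ Finset.Ico c t, if l + 1 = (r : ℕ) then (1 : ℂ) else 0) =
        if (r : ℕ) ∈ Finset.Ioc c t then 1 else 0 := by
      rw [Finset.sum_Ico_add' (fun l => if l = (r : ℕ) then (1 : ℂ) else 0) c t 1,
        Finset.sum_ite_eq']
      simp only [Finset.mem_Ico, Finset.mem_Ioc]
      congr 1
      simp only [eq_iff_iff]; omega
    rw [h2, Finset.sum_ite_eq']
    ring
  have hst' : (s : ℕ) < t := hst
  have ht := t.isLt
  -- Additivity of μ over intervals supplies the constant parameter difference, equal to the
  -- parameter at s itself.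
  have hsplit : ∀ c < (s : ℕ), muNat ν c t - muNat ν c s = muNat ν s t := by
    intro c hc
    rw [muNat, muNat, muNat, ← Finset.sum_Ico_consecutive _ hc.le hst'.le]
    ring
  simp only [phiU_eq_chain]
  have e1 : chain (simpleU n) (vecU n 0) (fun c => muNat (shift t ν) c s) s =
      chain (simpleU n) (vecU n 0) (fun c => muNat ν c s) s := by
    refine chain_congr _ _ _ fun c hc => ?_
    rw [hmu t c s (by omega) (by omega), if_neg (by simp; omega), if_neg (by simp; omega)]
    ring
  have e2 : chain (simpleU n) (vecU n 0) (fun c => muNat (shift s ν) c t) t =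
      chain (simpleU n) (vecU n 0)
        (Function.update (fun c => muNat ν c t) s (muNat ν s t - 1)) t := by
    refine chain_congr _ _ _ fun c hc => ?_
    simp only [Function.update_apply]
    rw [hmu s c t (by omega) (by omega)]
    simp only [Finset.mem_Ico, Finset.mem_Ioc]
    rcases eq_or_ne c (s : ℕ) with rfl | hcs
    · rw [if_pos rfl, if_pos ⟨le_rfl, hst'⟩, if_neg (by omega)]
      ring
    · rw [if_neg hcs]
      split_ifs <;> first | omega | ring
  rw [e1, e2]
  exact (serreData_simpleU n).chain_mul_chain (x := fun c => muNat ν c t) hst' hsplit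

end Enveloping

/-! ### Simple raising operators acting on chains. -/

section Raising
attribute [local instance] LieRing.ofAssociativeRing LieAlgebra.ofAssociativeAlgebra

section Abstract

variable {A : Type*} [Ring A] [Algebra ℂ A] {V : Type*} [AddCommGroup V] [Module ℂ V]

theorem map_map_eq_of_lie (ρ : A →ₐ[ℂ] Module.End ℂ V) {a b c : A} (h : ⁅a, b⁆ = c) (u : V) :
    ρ a (ρ b u) = ρ c u + ρ b (ρ a u) := by
  rw [← h, Ring.lie_def, map_sub, map_mul, map_mul, LinearMap.sub_apply, Module.End.mul_apply,
    Module.End.mul_apply, sub_add_cancel]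

theorem map_chain_succ_apply (ρ : A →ₐ[ℂ] Module.End ℂ V) (f : ℕ → A) (q : A) (x : ℕ → ℂ) (k : ℕ)
    (u : V) : ρ (chain f q x (k + 1)) u =
      (x k + 1) • ρ (f k) (ρ (chain f q x k) u) - x k • ρ (chain f q x k) (ρ (f k) u) := by
  simp only [chain, Ring.lie_def, map_add, map_smul, map_sub, map_mul, LinearMap.add_apply,
    LinearMap.smul_apply, LinearMap.sub_apply, Module.End.mul_apply]
  module

variable {f : ℕ → A} {q e h : A} {k : ℕ} {x : ℕ → ℂ} (ρ : A →ₐ[ℂ] Module.End ℂ V)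

/-- Since e meets only f_k, it turns each f_k into h. The two orders f_k p_k and p_k f_k contribute
(x_k + 1)(c + 1) - x_k c. -/
theorem raise_chain_succ (hq : ⁅e, q⁆ = 0) (hne : ∀ j, j ≠ k → ⁅e, f j⁆ = 0) (hk : ⁅e, f k⁆ = h)
    (hh : ⁅h, chain f q x k⁆ = chain f q x k) {u : V} {c : ℂ} (heu : ρ e u = 0)
    (hhu : ρ h u = c • u) :
    ρ e (ρ (chain f q x (k + 1)) u) = (x k + c + 1) • ρ (chain f q x k) u := by
  have hc : ⁅e, chain f q x k⁆ = 0 := lie_chain_eq_zero x k hq fun j hj => hne j hj.ne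
  have h0 : ∀ w, ρ e (ρ (chain f q x k) w) = ρ (chain f q x k) (ρ e w) := fun w => by
    rw [map_map_eq_of_lie ρ hc, map_zero, LinearMap.zero_apply, zero_add]
  rw [map_chain_succ_apply, map_sub, map_smul, map_smul, map_map_eq_of_lie ρ hk, h0, h0,
    map_map_eq_of_lie ρ hk, heu, map_zero, map_zero, map_map_eq_of_lie ρ hh, hhu, add_zero,
    add_zero, map_smul]
  module

/-- At length k + 2 both terms become multiples of f_{k+1} p_k u. As f_{k+1} raises the h-weight by
one, the coefficient is (x_{k+1} + 1) x_{k+1} - x_{k+1} (x_{k+1} + 1) = 0. Later generators commute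
with e and h, but they act on u as well, so the induction runs over all u. -/
theorem raise_chain_eq_zero (H : SerreData f q) (hq : ⁅e, q⁆ = 0)
    (hne : ∀ j, j ≠ k → ⁅e, f j⁆ = 0) (hk : ⁅e, f k⁆ = h)
    (hh : ⁅h, chain f q x k⁆ = chain f q x k) (hsucc : ⁅h, f (k + 1)⁆ = f (k + 1))
    (hfar : ∀ j, k + 2 ≤ j → ⁅h, f j⁆ = 0) {c : ℂ} (hc : x k + c + 1 = x (k + 1)) (m : ℕ)
    (hm : k + 2 ≤ m) : ∀ {u : V}, ρ e u = 0 → ρ h u = c • u → ρ e (ρ (chain f q x m) u) = 0 := by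
  have hfe : ∀ j, j ≠ k → ∀ w, ρ e (ρ (f j) w) = ρ (f j) (ρ e w) := fun j hj w => by
    rw [map_map_eq_of_lie ρ (hne j hj), map_zero, LinearMap.zero_apply, zero_add]
  induction m, hm using Nat.le_induction with
  | base =>
    intro u heu hhu
    have heu' : ρ e (ρ (f (k + 1)) u) = 0 := by rw [hfe _ (by omega), heu, map_zero]
    have hhu' : ρ h (ρ (f (k + 1)) u) = (c + 1) • ρ (f (k + 1)) u := by
      rw [map_map_eq_of_lie ρ hsucc, hhu, map_smul]
      module
    have hcomm : ρ (chain f q x k) (ρ (f (k + 1)) u) = ρ (f (k + 1)) (ρ (chain f q x k) u) := by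
      rw [map_map_eq_of_lie ρ (H.lie_chain x k.lt_succ_self), map_zero, LinearMap.zero_apply,
        zero_add]
    rw [map_chain_succ_apply, map_sub, map_smul, map_smul, hfe _ (by omega),
      raise_chain_succ ρ hq hne hk hh heu hhu, raise_chain_succ ρ hq hne hk hh heu' hhu', hcomm,
      hc, ← hc, map_smul]
    module
  | succ m hm ih =>
    intro u heu hhu
    have heu' : ρ e (ρ (f m) u) = 0 := by rw [hfe _ (by omega), heu, map_zero]
    have hhu' : ρ h (ρ (f m) u) = c • ρ (f m) u := by
      rw [map_map_eq_of_lie ρ (hfar m hm), hhu, map_smul, map_zero, LinearMap.zero_apply, zero_add]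
    rw [map_chain_succ_apply, map_sub, map_smul, map_smul, hfe _ (by omega), ih heu hhu,
      ih heu' hhu', map_zero, smul_zero, smul_zero, sub_zero]

theorem lie_chain_of_weight {w : ℕ → ℂ} (hq : ⁅h, q⁆ = w 0 • q)
    (hf : ∀ j, ⁅h, f j⁆ = (w (j + 1) - w j) • f j) (x : ℕ → ℂ) (k : ℕ) :
    ⁅h, chain f q x k⁆ = w k • chain f q x k := by
  induction k with
  | zero => exact hq
  | succ k ih =>
    rw [chain, lie_add, lie_mul_eq, lie_smul, leibniz_lie, hf, ih, smul_lie, lie_smul,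
      smul_mul_assoc, mul_smul_comm]
    module

end Abstract

variable {n : ℕ}

/-- The simple root vectors of positive roots. -/
def simpleE (l : Fin n) : G n := unit l.castSucc l.succ l.castSucc_lt_succ.ne

theorem simpleU_val (l : Fin n) : simpleU n l = UniversalEnvelopingAlgebra.ι ℂ
    (unit l.succ l.castSucc l.castSucc_lt_succ.ne') := by
  rw [simpleU, lowU, dif_pos ⟨Nat.lt_succ_self _, Nat.succ_lt_succ l.isLt⟩]
  rfl

theorem lie_simpleE_simpleU_of_ne (l : Fin n) (j : ℕ) (h : j ≠ l) :
    ⁅UniversalEnvelopingAlgebra.ι ℂ (simpleE l), simpleU n j⁆ = 0 := by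
  by_cases hj : j < n
  · rw [show simpleU n j = _ from simpleU_val ⟨j, hj⟩, ← LieHom.map_lie, simpleE,
      lie_unit_unit_of_ne, map_zero]
    · simpa [Fin.ext_iff] using h.symm
    · simpa [Fin.ext_iff] using h.symm
  · rw [simpleU, lowU, dif_neg (by omega), lie_zero]

theorem lie_simpleE_simpleU (l : Fin n) :
    ⁅UniversalEnvelopingAlgebra.ι ℂ (simpleE l), simpleU n l⁆ =
      UniversalEnvelopingAlgebra.ι ℂ (H l) := by
  rw [simpleU_val, ← LieHom.map_lie, simpleE, lie_unit_unit_swap]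

theorem lie_simpleE_vecU (l : Fin n) :
    ⁅UniversalEnvelopingAlgebra.ι ℂ (simpleE l), vecU n 0⁆ = 0 := by
  rw [vecU, dif_pos n.succ_pos, ← LieHom.map_lie, simpleE, lie_unit_P_of_ne, map_zero]
  simp [Fin.ext_iff]

theorem lie_H_vecU (l : Fin n) :
    ⁅UniversalEnvelopingAlgebra.ι ℂ (H l), vecU n 0⁆ = epsH l 0 • vecU n 0 := by
  rw [vecU, dif_pos n.succ_pos, ← LieHom.map_lie, lie_H_P, map_smul]

theorem lie_H_simpleU (l : Fin n) (j : ℕ) :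
    ⁅UniversalEnvelopingAlgebra.ι ℂ (H l), simpleU n j⁆ =
      (epsH l (j + 1) - epsH l j) • simpleU n j := by
  by_cases hj : j < n
  · rw [show simpleU n j = _ from simpleU_val ⟨j, hj⟩, ← LieHom.map_lie, lie_H_unit, map_smul]
    rfl
  · rw [simpleU, lowU, dif_neg (by omega), lie_zero, smul_zero]

end Raising

/-! ### Singular vectors in modules and their weights. -/

section Modules

variable {n : ℕ} {V : Type*} [AddCommGroup V] [Module ℂ V] [LieRingModule (G n) V]
  [LieModule ℂ (G n) V]

theorem act_mul (x y : U n) (u : V) : act (x * y) u = act x (act y u) := by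
  simp [act]

theorem act_zero (x : U n) : act x (0 : V) = 0 := by
  simp [act]

theorem act_ι (g : G n) (u : V) : act (UniversalEnvelopingAlgebra.ι ℂ g : U n) u = ⁅g, u⁆ := by
  simp [act]

/-- Vectors of weight `ν` killed by the simple root vectors of positive roots. -/
structure IsSingular (p : Weight n × V) : Prop where
  weight : ∀ l : Fin n, ⁅(H l : G n), p.2⁆ = p.1 l • p.2
  raise : ∀ l : Fin n, ⁅simpleE l, p.2⁆ = 0

theorem shift_apply (b : Fin (n + 1)) (ν : Weight n) (l : Fin n) :
    shift b ν l = ν l + epsH l b := by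
  simp only [shift, epsH, Fin.ext_iff, Fin.val_castSucc, Fin.val_succ, eq_comm (a := (b : ℕ))]
  ring

theorem epsH_self (l : ℕ) : epsH l l = 1 := by simp [epsH]

theorem muNat_succ (ν : Weight n) (l : Fin n) {t : ℕ} (ht : (l : ℕ) < t) :
    muNat ν l t + ν l + 1 = muNat ν (l + 1) t := by
  rw [muNat, muNat, Finset.sum_eq_sum_Ico_succ_bot ht, dif_pos l.isLt]
  ring

/-- A raising operator with b ≤ l commutes with the whole chain. For b = l + 1 the resulting scalar
is an empty sum μ_{b,b} = 0. For b ≥ l + 2 the recursion `muNat_succ` is the hypothesis that makes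
the coefficients cancel. -/
theorem IsSingular.phi {p : Weight n × V} (hp : IsSingular p) (b : Fin (n + 1)) :
    IsSingular (phi b p) where
  weight l := by
    have h := map_map_eq_of_lie (UniversalEnvelopingAlgebra.lift ℂ (LieModule.toEnd ℂ (G n) V))
      (lie_chain_of_weight (lie_H_vecU l) (lie_H_simpleU l) (fun c => muNat p.1 c b) b) p.2
    rw [← phiU_eq_chain] at h
    change act _ (act _ _) = act _ _ + act _ (act _ _) at h
    rw [act_ι, act_ι, hp.weight] at h
    refine h.trans ?_
    simp only [SlAffine.phi, shift_apply]
    simp only [act, map_smul, LinearMap.smul_apply]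
    module
  raise l := by
    let ρ := UniversalEnvelopingAlgebra.lift ℂ (LieModule.toEnd ℂ (G n) V)
    let x : ℕ → ℂ := fun c => muNat p.1 c b
    have he : ρ (UniversalEnvelopingAlgebra.ι ℂ (simpleE l)) p.2 = 0 :=
      (act_ι _ _).trans (hp.raise l)
    have hh : ρ (UniversalEnvelopingAlgebra.ι ℂ (H l)) p.2 = p.1 l • p.2 :=
      (act_ι _ _).trans (hp.weight l)
    have hw : ⁅UniversalEnvelopingAlgebra.ι ℂ (H l), chain (simpleU n) (vecU n 0) x l⁆ =
        chain (simpleU n) (vecU n 0) x l := by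
      refine (lie_chain_of_weight (lie_H_vecU l) (lie_H_simpleU l) x l).trans ?_
      rw [epsH_self, one_smul]
    suffices ρ (UniversalEnvelopingAlgebra.ι ℂ (simpleE l))
        (ρ (chain (simpleU n) (vecU n 0) x b) p.2) = 0 by
      rw [← phiU_eq_chain] at this
      exact (act_ι _ _).symm.trans this
    rcases lt_trichotomy (b : ℕ) (l + 1) with hb | hb | hb
    · rw [map_map_eq_of_lie ρ (lie_chain_eq_zero x b (lie_simpleE_vecU l)
        fun j hj => lie_simpleE_simpleU_of_ne l j (by omega)), he]
      simp
    · rw [hb, raise_chain_succ ρ (lie_simpleE_vecU l) (lie_simpleE_simpleU_of_ne l)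
        (lie_simpleE_simpleU l) hw he hh]
      simp only [x]
      rw [muNat_succ p.1 l (by omega), hb]
      simp [muNat]
    · refine raise_chain_eq_zero ρ (serreData_simpleU n) (lie_simpleE_vecU l)
        (lie_simpleE_simpleU_of_ne l) (lie_simpleE_simpleU l) hw ?_ (fun j hj => ?_)
        (muNat_succ p.1 l (by omega)) b hb he hh
      · refine (lie_H_simpleU l _).trans ?_
        have h1 : (l : ℕ) + 1 + 1 ≠ l := by omega
        simp [epsH, h1]
      · refine (lie_H_simpleU l _).trans ?_
        have h1 : j ≠ l := by omega
        have h2 : j ≠ l + 1 := by omega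
        have h3 : j + 1 ≠ l := by omega
        simp [epsH, h1, h2, h3]

/-- Carrying the weight along with the vector makes this an identity of maps on all pairs, singular
or not. -/
theorem phi_comm (s t : Fin (n + 1)) :
    Function.Commute (phi (V := V) s) (phi (V := V) t) := by
  have key : ∀ {s t : Fin (n + 1)}, s < t → Function.Commute (phi (V := V) s) (phi t) := by
    intro s t hst p
    refine Prod.ext (funext fun l => ?_) ?_
    · simp only [phi, shift_apply]; ring
    · simp only [phi, ← act_mul, phiU_comm _ hst]
  rcases lt_trichotomy s t with h | rfl | h
  · exact key h
  · exact Function.Commute.refl _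
  · exact (key h).symm

theorem IsSingular.iterate_phi {p : Weight n × V} (hp : IsSingular p) (b : Fin (n + 1)) (m : ℕ) :
    IsSingular ((SlAffine.phi b)^[m] p) := by
  induction m with
  | zero => exact hp
  | succ m ih => rw [Function.iterate_succ_apply']; exact ih.phi b

theorem iterate_phi_fst (p : Weight n × V) (b : Fin (n + 1)) (m : ℕ) (l : Fin n) :
    ((phi b)^[m] p).1 l = p.1 l + m * epsH l b := by
  induction m with
  | zero => simp
  | succ m ih => simp only [Function.iterate_succ_apply', phi, shift_apply, ih]; push_cast; ring

theorem iterate_phi_snd_zero (b : Fin (n + 1)) (m : ℕ) (p : Weight n × V) (h : p.2 = 0) :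
    ((phi b)^[m] p).2 = 0 := by
  induction m with
  | zero => exact h
  | succ m ih => rw [Function.iterate_succ_apply', phi, ih, act_zero]

theorem H_ne_zero (l : Fin n) : (H l : G n) ≠ 0 := by
  intro h
  have h1 := lie_H_P l l.castSucc
  rw [h, zero_lie, Fin.val_castSucc, epsH_self, one_smul, P, eq_comm,
    ← map_zero (SemiDirectSum.inl (stdRep n))] at h1
  have h2 := congrFun (SemiDirectSum.inl_injective (stdRep n) h1) l.castSucc
  simp at h2

theorem isSl2Triple_simple (l : Fin n) : IsSl2Triple (H l) (simpleE l)
    (unit l.succ l.castSucc l.castSucc_lt_succ.ne' : G n) where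
  h_ne_zero := H_ne_zero l
  lie_e_f := lie_unit_unit_swap l
  lie_h_e_nsmul := by
    rw [simpleE, lie_H_unit, ← Nat.cast_smul_eq_nsmul ℂ]
    congr 1
    simp [epsH]
    norm_num
  lie_h_f_nsmul := by
    rw [lie_H_unit, ← Nat.cast_smul_eq_nsmul ℂ, ← neg_smul]
    congr 1
    simp [epsH]
    norm_num

variable [FiniteDimensional ℂ V]

theorem IsSingular.exists_nat {p : Weight n × V} (hp : IsSingular p) (h : p.2 ≠ 0) (l : Fin n) :
    ∃ m : ℕ, p.1 l = m :=
  IsSl2Triple.HasPrimitiveVectorWith.exists_nat (R := ℂ) (t := isSl2Triple_simple l)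
    ⟨h, hp.weight l, hp.raise l⟩

/-- After m + 1 steps the coordinate at H_l would be -1, impossible for a nonzero singular vector.
-/
theorem IsSingular.iterate_phi_succ {p : Weight n × V} (hp : IsSingular p) (l : Fin n) {m : ℕ}
    (hm : p.1 l = m) : ((SlAffine.phi l.succ)^[m + 1] p).2 = 0 := by
  by_contra h
  obtain ⟨k, hk⟩ := (hp.iterate_phi l.succ (m + 1)).exists_nat h l
  rw [iterate_phi_fst, hm] at hk
  simp only [epsH, Fin.val_succ, if_neg (Nat.succ_ne_self _), if_true] at hk
  have : (k : ℂ) + 1 = 0 := by rw [← hk]; push_cast; ring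
  exact Nat.cast_add_one_ne_zero k this

/-- Each step raises the H_1-eigenvalue by one, so nonvanishing iterates would form an infinite
linearly independent family. -/
theorem IsSingular.exists_iterate_phi_zero {p : Weight n × V} (hp : IsSingular p) (hn : 1 ≤ n) :
    ∃ m, ((SlAffine.phi 0)^[m] p).2 = 0 := by
  by_contra! h
  let l : Fin n := ⟨0, hn⟩
  have h1 := Module.End.eigenvectors_linearIndependent' (LieModule.toEnd ℂ (G n) V (H l))
    (fun m : ℕ => p.1 l + m) (fun a b hab => by simpa using hab)
    (fun m => ((SlAffine.phi 0)^[m] p).2) (fun m => by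
      refine Module.End.hasEigenvector_iff.mpr ⟨Module.End.mem_eigenspace_iff.mpr ?_, h m⟩
      rw [LieModule.toEnd_apply_apply, (hp.iterate_phi 0 m).weight l, iterate_phi_fst]
      simp [epsH, l])
  exact Module.Finite.not_linearIndependent_of_infinite _ h1

end Modules
end

/-! ### Monotonicity and existence of the numbers J. -/

section Killing

variable {n : ℕ} {V : Type*} [AddCommGroup V] [Module ℂ V] [LieRingModule (G n) V]
  [LieModule ℂ (G n) V]

/-- Enlarging the exponents of a word amounts to applying a map which commutes with all `phi`. -/
theorem word_of_le (μ : Weight n) (v : V) (k : ℕ) (hk : k ≤ n + 1) (i j : Fin k → ℕ)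
    (hij : ∀ l, j l ≤ i l) : ∃ Φ : Weight n × V → Weight n × V,
      (∀ b, Function.Commute Φ (phi b)) ∧ (∀ p, p.2 = 0 → (Φ p).2 = 0) ∧
        word μ v k hk i = Φ (word μ v k hk j) := by
  induction k with
  | zero => exact ⟨id, fun b => Function.Commute.id_left, fun _ h => h, rfl⟩
  | succ k ih =>
    obtain ⟨Φ, hΦ, h0, hw⟩ := ih (Nat.le_of_succ_le hk) (Fin.init i) (Fin.init j)
      fun l => hij l.castSucc
    -- The surplus powers of the last φ are composed with the map already found for the initial
    -- exponents, which can be pulled out past the remaining powers.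
    refine ⟨(phi ⟨k, hk⟩)^[i (Fin.last k) - j (Fin.last k)] ∘ Φ,
      fun b => ((phi_comm _ b).iterate_left _).comp_left (hΦ b),
      fun p hp => iterate_phi_snd_zero _ _ _ (h0 p hp), ?_⟩
    rw [word, word, hw, Function.comp_apply, ((hΦ ⟨k, hk⟩).iterate_right _).eq,
      ← Function.iterate_add_apply, Nat.sub_add_cancel (hij _)]

theorem word_zero (μ : Weight n) (v : V) (k : ℕ) (hk : k ≤ n + 1) :
    word μ v k hk (fun _ => 0) = (μ, v) := by
  induction k with
  | zero => rfl
  | succ k ih => exact ih (Nat.le_of_succ_le hk)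

theorem killing_mono (μ : Weight n) (v : V) (k : Fin (n + 1)) {i j : Fin k.val → ℕ}
    (hij : ∀ l, j l ≤ i l) : killing μ v k j ⊆ killing μ v k i := by
  rintro m ⟨hm, h⟩
  obtain ⟨Φ, hΦ, h0, hw⟩ := word_of_le μ v k.val k.isLt.le i j hij
  refine ⟨hm, ?_⟩
  rw [hw, ← ((hΦ k).iterate_right m).eq]
  exact h0 _ h

theorem J_mono (μ : Weight n) (v : V) (k : Fin (n + 1)) {i j : Fin k.val → ℕ}
    (hne : (killing μ v k j).Nonempty) (hij : ∀ l, j l ≤ i l) : J μ v k i ≤ J μ v k j :=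
  Nat.sInf_le (killing_mono μ v k hij (Nat.sInf_mem hne))

theorem IsHighestWeightVector.isSingular {μ : Weight n} {v : V} (hv : IsHighestWeightVector μ v) :
    IsSingular (μ, v) :=
  ⟨hv.weight, fun l => hv.raise l.castSucc l.succ l.castSucc_lt_succ⟩

variable [FiniteDimensional ℂ V]

theorem killing_succ_zero {μ : Weight n} {v : V} (hv : IsHighestWeightVector μ v) (l : Fin n) :
    ∃ m : ℕ, μ l = m ∧ m + 1 ∈ killing μ v l.succ (fun _ => 0) := by
  obtain ⟨m, hm⟩ := hv.isSingular.exists_nat hv.ne_zero l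
  exact ⟨m, hm, m.succ_pos, by
    rw [word_zero]
    exact hv.isSingular.iterate_phi_succ l hm⟩

theorem killing_nonempty (hn : 1 ≤ n) {μ : Weight n} {v : V} (hv : IsHighestWeightVector μ v)
    (k : Fin (n + 1)) (i : Fin k.val → ℕ) : (killing μ v k i).Nonempty := by
  refine Set.Nonempty.mono (killing_mono μ v k (j := fun _ => 0) fun l => Nat.zero_le _) ?_
  induction k using Fin.cases with
  | zero =>
    obtain ⟨m, hm⟩ := hv.isSingular.exists_iterate_phi_zero hn
    refine ⟨m, Nat.pos_of_ne_zero ?_, hm⟩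
    rintro rfl
    exact hv.ne_zero hm
  | succ l =>
    obtain ⟨m, -, hm⟩ := killing_succ_zero hv l
    exact ⟨_, hm⟩

end Killing

end SlAffine

/-! ### The assertions on the numbers J. -/

theorem theorem3 (n : ℕ) (hn : 1 ≤ n) {V : Type*} [AddCommGroup V] [Module ℂ V]
    [FiniteDimensional ℂ V] [LieRingModule (SlAffine.G n) V] [LieModule ℂ (SlAffine.G n) V]
    (μ : SlAffine.Weight n) (v : V) (hv : SlAffine.IsHighestWeightVector μ v)
    (hcyc : SlAffine.IsCyclicGenerator (n := n) v) :
    -- all the numbers of the set are well defined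
    (∀ (k : Fin (n + 1)) (i : Fin k.val → ℕ), SlAffine.Admissible μ v k i →
      IsLeast (SlAffine.killing μ v k i) (SlAffine.J μ v k i)) ∧
    -- (1)
    1 ≤ SlAffine.J μ v 0 Fin.elim0 ∧
    -- (2)
    BddAbove (SlAffine.JSet μ v) ∧
    -- (3)
    (∀ (k : Fin (n + 1)) (i j : Fin k.val → ℕ), SlAffine.Admissible μ v k i →
      (∀ l, j l ≤ i l) →
      SlAffine.Admissible μ v k j ∧ SlAffine.J μ v k i ≤ SlAffine.J μ v k j) ∧
    -- (4)
    (∀ (l : Fin n) (i : Fin l.succ.val → ℕ), SlAffine.Admissible μ v l.succ i →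
      ∃ m : ℕ, μ l = (m : ℂ) ∧
        1 ≤ SlAffine.J μ v l.succ i ∧ SlAffine.J μ v l.succ i ≤ m + 1) := by
  -- Nonemptiness, valid for every tuple, ensures that `sInf` is a true minimum and not the default
  -- value 0.
  have hne := SlAffine.killing_nonempty hn hv
  have hleast : ∀ (k : Fin (n + 1)) (i : Fin k.val → ℕ),
      IsLeast (SlAffine.killing μ v k i) (SlAffine.J μ v k i) := fun k i =>
    ⟨Nat.sInf_mem (hne k i), fun _ hm => Nat.sInf_le hm⟩
  refine ⟨fun k i _ => hleast k i, (hleast 0 Fin.elim0).1.1, ?_, ?_, ?_⟩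
  -- For each k the zero tuple gives the largest value; the sum over k is a crude common bound.
  · refine ⟨∑ k : Fin (n + 1), SlAffine.J μ v k fun _ => 0, ?_⟩
    rintro _ ⟨k, i, -, rfl⟩
    exact (SlAffine.J_mono μ v k (hne k _) fun l => Nat.zero_le _).trans
      (Finset.single_le_sum (f := fun k => SlAffine.J μ v k fun _ => 0)
        (fun _ _ => Nat.zero_le _) (Finset.mem_univ k))
  · intro k i j hi hij
    refine ⟨fun h => ?_, SlAffine.J_mono μ v k (hne k j) hij⟩
    -- Admissibility descends by j_h ≤ i_h < J_h(i) ≤ J_h(j), the last step by monotonicity.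
    exact ((hij h).trans_lt (hi h)).trans_le
      (SlAffine.J_mono μ v _ (hne _ _) fun l => hij _)
  · intro l i _
    obtain ⟨m, hm, hk⟩ := SlAffine.killing_succ_zero hv l
    exact ⟨m, hm, (hleast _ i).1.1, Nat.sInf_le
      (SlAffine.killing_mono μ v l.succ (fun _ => Nat.zero_le _) hk)⟩
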